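/- A search tree on a finite connected graph $G$ is a rooted tree with vertex set $V(G)$ defined recursively: its root is a vertex $r\in V(G)$, and the children of $r$ are the roots of search trees on the connected components of $G-r$ (one child for each component). If $T$ is a search tree on $G$ and $v$ is a child of $u$ in $T$, the rotation of $u$ and $v$ produces the search tree $T'$ in which $v$ takes the place of $u$ (as a child of the former parent of $u$, or as the root if $u$ was the root), $u$ is a child of $v$, every other subtree of $u$ remains a subtree of $u$, and each subtree $S$ of $v$ in $T$ becomes a subtree of $u$ if $u$ is adjacent in $G$ to a vertex of $S$ and remains a subtree of $v$ otherwise. The rotation graph $\mathcal{R}(G)$ has the search trees on $G$ as its vertices, two of them being adjacent if they differ by one rotation. Let $p,q$ be positive integers with $\min\{2,\tfrac p4\}\le q\le 4p$, and let $K_{p,q}$ be the complete bipartite graph with parts of sizes $p$ and $q$. Then \[ pq+\left\lfloor \tfrac12\binom q2\right\rfloor\;\le\;\operatorname{diam}(\mathcal{R}(K_{p,q})). \] Moreover, this bound is strictly better than the lower bound $\binom q2$: one has $\binom q2<pq+\left\lfloor \tfrac12\binom q2\right\rfloor$. -/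

import Mathlib

/-- `D` is (the vertex set of) a connected component of the subgraph of `G` induced by `S`. -/
def IsComponentIn {V : Type*} (G : SimpleGraph V) (S D : Set V) : Prop :=
  ∃ c : (G.induce S).ConnectedComponent, D = Subtype.val '' c.supp

/-- `IsSearchTreeOn G parent C r`: the rooted tree with vertex set `C` and root `r` described by
the parent function `parent` is a search tree on the subgraph of `G` induced by `C`. That is,
`r ∈ C`, and the children of `r` are the roots of search trees on the connected components of
`G[C] - r`, one for each component; `child D` is the root of the tree on the component `D`. -/
inductive IsSearchTreeOn {V : Type*} (G : SimpleGraph V) (parent : V → Option V) :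
    Set V → V → Prop
  | node (C : Set V) (r : V) (child : Set V → V) (mem : r ∈ C)
      (parent_child : ∀ D, IsComponentIn G (C \ {r}) D → parent (child D) = some r)
      (rec_child : ∀ D, IsComponentIn G (C \ {r}) D → IsSearchTreeOn G parent D (child D)) :
      IsSearchTreeOn G parent C r

/-- A search tree on the connected graph `G`: a rooted tree with vertex set `V`, encoded by its
parent function (the root has no parent), satisfying the recursive condition above. -/
@[ext]
structure SearchTree {V : Type*} (G : SimpleGraph V) where
  parent : V → Option V
  isSearchTree : ∃ r, parent r = none ∧ IsSearchTreeOn G parent Set.univ r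

namespace SearchTree

variable {V : Type*} {G : SimpleGraph V}

/-- The vertex set of the subtree rooted at `v`: `v` and all its descendants. -/
def subtree (T : SearchTree G) (v : V) : Set V :=
  {w | Relation.ReflTransGen (fun a b => T.parent a = some b) w v}

open Classical in
/-- The parent function of the tree obtained from `T` by the rotation of `u` and its child `v`:
`v` takes the place of `u`, `u` becomes a child of `v`, and each child `w` of `v` whose subtree
contains a neighbour of `u` becomes a child of `u`. All other parents are unchanged. -/
noncomputable def rotatedParent (T : SearchTree G) (u v : V) : V → Option V := fun w =>
  if w = v then T.parent u
  else if w = u then some v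
  else if T.parent w = some v ∧ ∃ s ∈ T.subtree w, G.Adj u s then some u
  else T.parent w

/-- `T'` is obtained from `T` by one rotation. -/
def IsRotation (T T' : SearchTree G) : Prop :=
  ∃ u v, T.parent v = some u ∧ T'.parent = T.rotatedParent u v

end SearchTree

/-- The rotation graph of `G`: its vertices are the search trees on `G`; two distinct search trees
are adjacent when one of them is obtained from the other by one rotation. -/
def rotationGraph {V : Type*} (G : SimpleGraph V) : SimpleGraph (SearchTree G) :=
  SimpleGraph.fromRel SearchTree.IsRotation

/-! Rotating `u` and its child `v` reverses the ancestor relation of this pair and of no other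
(`flips_of_adj`). Hence a walk of rotations is at least as long as the number of reversals along it,
summed over any set of pairs (`sum_flipCount_le`).

Let a_i and b_j be the vertices of the two parts. In the first tree b_0, b_1, ... lie above all a_i;
in the second the order of the b_j is reversed and exactly the last `h j` of the a_i lie below b_j.
Each a_i is always comparable with each b_j, and b_j is comparable with every b_j' while some a_i
lies below b_j. Along a shortest walk let S be the set of j such that b_j is at some time below
every a_i. If j ∈ S, then b_j takes part in at least p + h j reversals with the a_i, since its `h j`
final descendants are each reversed twice; otherwise in at least p - h j. A pair b_j, b_j' not both
from S stays comparable, so it is reversed. With s = |S| the walk has length at least pq + C(q,2) -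
Σ h + (2 Σ_S h - C(s,2)) (`exists_le_diam`).

For Σ h = ⌈C(q,2)/2⌉ with values as equal as possible, the bracket is nonnegative for every S
(`choose_two_le_two_mul_sum`), and q ≤ 4p ensures h ≤ p. Sorting a tree by rotations
(`exists_adj_inversions_lt`) supplies both trees and the connectedness of the rotation graph. -/

section ParentFunction

/-! ### Parent functions, ancestors, and walks inside a vertex set -/

variable {V : Type*} {G : SimpleGraph V}

/-- `Desc par w v`: `v` is reached from `w` by iterating the parent function. -/
def Desc (par : V → Option V) : V → V → Prop :=
  Relation.ReflTransGen (fun a b => par a = some b)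

namespace Desc

variable {par : V → Option V} {u v w x y : V}

theorem of_parent (h : par x = some y) : Desc par x y := Relation.ReflTransGen.single h

theorem eq_or_of_parent (h : Desc par x y) (hx : par x = some u) : x = y ∨ Desc par u y := by
  rcases Relation.ReflTransGen.cases_head h with h | ⟨c, hc, h⟩
  · exact Or.inl h
  · rw [hx] at hc
    obtain rfl := Option.some.inj hc
    exact Or.inr h

theorem eq_of_parent_eq_none (h : Desc par x y) (hx : par x = none) : x = y := by
  rcases Relation.ReflTransGen.cases_head h with h | ⟨c, hc, h⟩
  · exact h
  · simp [hx] at hc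

/-- The ancestors of `w` form a chain, because a vertex has at most one parent. -/
theorem total (hx : Desc par w x) (hy : Desc par w y) : Desc par x y ∨ Desc par y x := by
  induction hx using Relation.ReflTransGen.head_induction_on with
  | refl => exact Or.inl hy
  | head h h' ih =>
    rcases hy.eq_or_of_parent h with rfl | hy
    · exact Or.inr (Relation.ReflTransGen.head h h')
    · exact ih hy

end Desc

/-- One step of a walk of `G` inside `S`. -/
def StepIn (G : SimpleGraph V) (S : Set V) (a b : V) : Prop := G.Adj a b ∧ a ∈ S ∧ b ∈ S

/-- `x` and `y` are joined by a walk of `G` inside `S`. -/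
def WalkIn (G : SimpleGraph V) (S : Set V) : V → V → Prop := Relation.ReflTransGen (StepIn G S)

namespace WalkIn

variable {S S' : Set V} {x y : V}

theorem symm (h : WalkIn G S x y) : WalkIn G S y x := by
  induction h with
  | refl => exact Relation.ReflTransGen.refl
  | tail _ h ih => exact ih.head ⟨h.1.symm, h.2.2, h.2.1⟩

theorem mono (hS : S ⊆ S') (h : WalkIn G S x y) : WalkIn G S' x y := by
  induction h with
  | refl => exact Relation.ReflTransGen.refl
  | tail _ h ih => exact ih.tail ⟨h.1, hS h.2.1, hS h.2.2⟩

theorem mem_of_closed {P : Set V} (h : WalkIn G S x y) (hx : x ∈ P)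
    (hP : ∀ a b, G.Adj a b → a ∈ S → b ∈ S → a ∈ P → b ∈ P) : y ∈ P := by
  induction h with
  | refl => exact hx
  | tail _ h ih => exact hP _ _ h.1 h.2.1 h.2.2 ih

theorem iff_reachable (hx : x ∈ S) (hy : y ∈ S) :
    WalkIn G S x y ↔ (G.induce S).Reachable ⟨x, hx⟩ ⟨y, hy⟩ := by
  constructor
  · intro h
    induction h with
    | refl => rfl
    | tail _ h ih => exact (ih h.2.1).trans (SimpleGraph.Adj.reachable (by simpa using h.1))
  · intro h
    rw [SimpleGraph.reachable_iff_reflTransGen] at h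
    exact Relation.ReflTransGen.lift (p := StepIn G S) Subtype.val
      (fun a b hab => ⟨by simpa using hab, a.2, b.2⟩) _ _ h

end WalkIn

theorem isComponentIn_iff {S D : Set V} :
    IsComponentIn G S D ↔ ∃ x ∈ S, D = {y | y ∈ S ∧ WalkIn G S x y} := by
  constructor
  · rintro ⟨c, rfl⟩
    induction c using SimpleGraph.ConnectedComponent.ind with | _ x
    refine ⟨x, x.2, ?_⟩
    ext y
    constructor
    · rintro ⟨y, hy, rfl⟩
      refine ⟨y.2, (WalkIn.iff_reachable x.2 y.2).2 ?_⟩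
      exact (SimpleGraph.ConnectedComponent.exact hy).symm
    · rintro ⟨hy, h⟩
      exact ⟨⟨y, hy⟩, SimpleGraph.ConnectedComponent.sound
        ((WalkIn.iff_reachable x.2 hy).1 h).symm, rfl⟩
  · rintro ⟨x, hx, rfl⟩
    refine ⟨(G.induce S).connectedComponentMk ⟨x, hx⟩, ?_⟩
    ext y
    constructor
    · rintro ⟨hy, h⟩
      exact ⟨⟨y, hy⟩, SimpleGraph.ConnectedComponent.sound
        ((WalkIn.iff_reachable hx hy).1 h).symm, rfl⟩
    · rintro ⟨y, hy, rfl⟩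
      refine ⟨y.2, (WalkIn.iff_reachable hx y.2).2 ?_⟩
      exact (SimpleGraph.ConnectedComponent.exact hy).symm

theorem exists_isComponentIn (G : SimpleGraph V) {S : Set V} {x : V} (hx : x ∈ S) :
    ∃ D, IsComponentIn G S D ∧ x ∈ D :=
  ⟨_, isComponentIn_iff.2 ⟨x, hx, rfl⟩, hx, Relation.ReflTransGen.refl⟩

/-- A non-recursive description of the parent functions of search trees. -/
structure IsSearchParent (G : SimpleGraph V) (par : V → Option V) : Prop where
  antisymm : ∀ {x y}, Desc par x y → Desc par y x → x = y
  parent_ne : ∀ {x}, par x ≠ some x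
  comparable : ∀ {x y}, G.Adj x y → Desc par x y ∨ Desc par y x
  exists_adj : ∀ {w v}, par w = some v → ∃ s, Desc par s w ∧ G.Adj v s

/-! ### From the recursive definition to the ancestor order -/

namespace IsSearchTreeOn

variable {par : V → Option V} {C : Set V} {r : V}

theorem desc_root (h : IsSearchTreeOn G par C r) : ∀ w ∈ C, Desc par w r := by
  induction h with
  | node C r child mem pc rc ih =>
    intro w hw
    by_cases hwr : w = r
    · rw [hwr]; exact Relation.ReflTransGen.refl
    · obtain ⟨D, hD, hwD⟩ := exists_isComponentIn G (show w ∈ C \ {r} from ⟨hw, hwr⟩)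
      exact Relation.ReflTransGen.tail (ih D hD w hwD) (pc D hD)

theorem comparable (h : IsSearchTreeOn G par C r) :
    ∀ x ∈ C, ∀ y ∈ C, G.Adj x y → Desc par x y ∨ Desc par y x := by
  induction h with
  | node C r child mem pc rc ih =>
    have hT := IsSearchTreeOn.node C r child mem pc rc
    intro x hx y hy hxy
    by_cases hxr : x = r
    · subst hxr; exact Or.inr (hT.desc_root y hy)
    by_cases hyr : y = r
    · subst hyr; exact Or.inl (hT.desc_root x hx)
    have hx' : x ∈ C \ {r} := ⟨hx, hxr⟩
    have hy' : y ∈ C \ {r} := ⟨hy, hyr⟩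
    have hD := (isComponentIn_iff (G := G)).2 ⟨x, hx', rfl⟩
    exact ih _ hD x ⟨hx', Relation.ReflTransGen.refl⟩ y
      ⟨hy', Relation.ReflTransGen.single ⟨hxy, hx', hy'⟩⟩ hxy

/-- If `r` had no neighbour in a component `D`, a walk inside `C` from `D` to `r` could never leave
`D`. -/
theorem exists_adj (h : IsSearchTreeOn G par C r) (hC : ∀ x ∈ C, ∀ y ∈ C, WalkIn G C x y) :
    ∀ w ∈ C, w ≠ r → ∀ v, par w = some v → ∃ s, Desc par s w ∧ G.Adj v s := by
  induction h with
  | node C r child mem pc rc ih =>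
    intro w hw hwr v hv
    obtain ⟨D, hD, hwD⟩ := exists_isComponentIn G (show w ∈ C \ {r} from ⟨hw, hwr⟩)
    have hD' := hD
    obtain ⟨z, hz, hDz⟩ := isComponentIn_iff.1 hD
    by_cases hwc : w = child D
    · have hvr : r = v := by
        have := pc D hD
        rw [← hwc, hv] at this
        exact (Option.some.inj this).symm
      subst hvr
      by_contra! hcon
      have hmem : r ∈ D := by
        refine (hC w hw r mem).mem_of_closed hwD ?_
        intro a b hab ha hb haD
        have hbr : b ≠ r := by
          rintro rfl
          refine hcon a ?_ hab.symm
          rw [hwc]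
          exact (rc D hD).desc_root a haD
        rw [hDz] at haD ⊢
        exact ⟨⟨hb, hbr⟩, haD.2.tail ⟨hab, haD.1, hb, hbr⟩⟩
      rw [hDz] at hmem
      exact hmem.1.2 rfl
    · refine ih D hD ?_ w hwD hwc v hv
      have key : ∀ x ∈ D, WalkIn G D z x := by
        intro x hx
        rw [hDz] at hx
        have := hx.2
        have hz' : z ∈ {y | WalkIn G D z y ∧ y ∈ D} :=
          ⟨Relation.ReflTransGen.refl, by rw [hDz]; exact ⟨hz, Relation.ReflTransGen.refl⟩⟩
        refine (this.mem_of_closed hz' ?_).1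
        rintro a b hab ha hb ⟨h1, h2⟩
        have hbD : b ∈ D := by
          rw [hDz] at h2 ⊢
          exact ⟨hb, h2.2.tail ⟨hab, ha, hb⟩⟩
        exact ⟨h1.tail ⟨hab, h2, hbD⟩, hbD⟩
      intro x hx y hy
      exact (key x hx).symm.trans (key y hy)

/-- Applied to a root without parent, this excludes cycles of parents and so makes `Desc`
antisymmetric. -/
theorem acc (h : IsSearchTreeOn G par C r) (hr : Acc (fun a b => par b = some a) r) :
    ∀ w ∈ C, Acc (fun a b => par b = some a) w := by
  induction h with
  | node C r child mem pc rc ih =>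
    intro w hw
    by_cases hwr : w = r
    · rwa [hwr]
    obtain ⟨D, hD, hwD⟩ := exists_isComponentIn G (show w ∈ C \ {r} from ⟨hw, hwr⟩)
    refine ih D hD (Acc.intro _ fun y hy => ?_) w hwD
    rw [pc D hD] at hy
    rwa [← Option.some.inj hy]

end IsSearchTreeOn

theorem SearchTree.isSearchParent (hG : G.Connected) (T : SearchTree G) :
    IsSearchParent G T.parent := by
  obtain ⟨r, hr, h⟩ := T.isSearchTree
  have hwf : WellFounded (fun a b => T.parent b = some a) :=
    ⟨fun a => h.acc (Acc.intro _ fun y hy => by simp [hr] at hy) a trivial⟩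
  have hwf' := hwf.transGen
  have hswap : ∀ {x y}, Relation.TransGen (fun a b => T.parent a = some b) x y →
      Relation.TransGen (fun a b => T.parent b = some a) y x := fun h =>
    Relation.transGen_swap.1 h
  refine ⟨?_, ?_, ?_, ?_⟩
  · intro x y hxy hyx
    by_contra hne
    rcases Relation.reflTransGen_iff_eq_or_transGen.1 hxy with h1 | h1
    · exact hne h1.symm
    · exact hwf'.irrefl.irrefl _ (hswap (h1.trans_left hyx))
  · intro x hx
    exact hwf'.irrefl.irrefl x (Relation.TransGen.single hx)
  · intro x y hxy
    exact h.comparable x trivial y trivial hxy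
  · intro w v hwv
    refine h.exists_adj ?_ w trivial ?_ v hwv
    · intro x _ y _
      have := hG.preconnected x y
      rw [SimpleGraph.reachable_iff_reflTransGen] at this
      exact Relation.ReflTransGen.mono (fun _ _ h => ⟨h, trivial, trivial⟩) _ _ this
    · rintro rfl
      simp [hr] at hwv

/-! ### From the ancestor order back to the recursive definition -/

namespace IsSearchParent

variable {par : V → Option V} {u v w x y r : V}

theorem parent_not_desc (h : IsSearchParent G par) (hv : par v = some u) : ¬ Desc par u v := by
  intro hu
  have := h.antisymm hu (Desc.of_parent hv)
  subst this
  exact h.parent_ne hv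

theorem ncard_lt [Finite V] (h : IsSearchParent G par) (hv : par v = some u) :
    {w | Desc par w v}.ncard < {w | Desc par w u}.ncard := by
  refine Set.ncard_lt_ncard ⟨fun w hw => hw.tail hv, fun hsub => ?_⟩
  exact h.parent_not_desc hv (hsub (show u ∈ {w | Desc par w u} from Relation.ReflTransGen.refl))

/-- Induction on the size of the subtree: the subtree of a child is connected and contains a
neighbour of the parent. -/
theorem joined [Finite V] (h : IsSearchParent G par) :
    ∀ (n : ℕ) (w : V), {x | Desc par x w}.ncard = n →
      ∀ y, Desc par y w → WalkIn G {x | Desc par x w} y w := by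
  intro n
  induction n using Nat.strong_induction_on with | _ n ih
  intro w hn y hy
  rcases Relation.ReflTransGen.cases_tail hy with rfl | ⟨c, hyc, hc⟩
  · exact Relation.ReflTransGen.refl
  · have ihc := ih _ (hn ▸ h.ncard_lt hc) c rfl
    obtain ⟨s, hs, hadj⟩ := h.exists_adj hc
    have hsub : {x | Desc par x c} ⊆ {x | Desc par x w} := fun x hx => hx.tail hc
    have h1 := WalkIn.mono hsub ((ihc y hyc).trans (ihc s hs).symm)
    exact h1.tail ⟨hadj.symm, hsub hs, Relation.ReflTransGen.refl⟩

/-- Adjacent vertices are comparable and ancestors form a chain, so inside the subtree of `r` an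
edge can leave the subtree of `w` only towards `r`. Hence the subtrees of the children of `r` are
the components. -/
theorem desc_of_adj (h : IsSearchParent G par) (hw : par w = some r) {a b : V} (hab : G.Adj a b)
    (ha : Desc par a w) (hb : Desc par b r) (hbr : b ≠ r) : Desc par b w := by
  rcases h.comparable hab with h1 | h1
  · rcases Desc.total h1 ha with h2 | h2
    · exact h2
    · rcases h2.eq_or_of_parent hw with rfl | h3
      · exact Relation.ReflTransGen.refl
      · exact absurd (h.antisymm hb h3) hbr
  · exact h1.trans ha

theorem isSearchTreeOn [Finite V] (h : IsSearchParent G par) :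
    ∀ (n : ℕ) (r : V), {x | Desc par x r}.ncard = n →
      IsSearchTreeOn G par {x | Desc par x r} r := by
  intro n
  induction n using Nat.strong_induction_on with | _ n ih
  intro r hn
  have key : ∀ D, IsComponentIn G ({x | Desc par x r} \ {r}) D →
      ∃ w, par w = some r ∧ D = {x | Desc par x w} := by
    intro D hD
    obtain ⟨x, ⟨hx, hxr⟩, rfl⟩ := isComponentIn_iff.1 hD
    rcases Relation.ReflTransGen.cases_tail hx with h0 | ⟨w, hxw, hw⟩
    · exact absurd h0.symm hxr
    refine ⟨w, hw, ?_⟩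
    have hsub : {x | Desc par x w} ⊆ {x | Desc par x r} \ {r} := by
      intro y hy
      refine ⟨hy.tail hw, ?_⟩
      rintro rfl
      exact h.parent_not_desc hw hy
    ext y
    constructor
    · rintro ⟨-, hy⟩
      exact hy.mem_of_closed (P := {x | Desc par x w}) hxw
        fun a b hab _ hb ha => h.desc_of_adj hw hab ha hb.1 hb.2
    · intro hy
      exact ⟨hsub hy,
        WalkIn.mono hsub ((h.joined _ w rfl x hxw).trans (h.joined _ w rfl y hy).symm)⟩
  classical
  choose child hchild using key
  refine IsSearchTreeOn.node _ r
    -- The value `r` on sets that are not components is a mere default.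
    (fun D => if hD : IsComponentIn G ({x | Desc par x r} \ {r}) D then child D hD else r)
    Relation.ReflTransGen.refl ?_ ?_
  · intro D hD
    simp only [dif_pos hD]
    exact (hchild D hD).1
  · intro D hD
    simp only [dif_pos hD]
    have := ih _ (hn ▸ h.ncard_lt (hchild D hD).1) _ rfl
    rwa [← (hchild D hD).2] at this

theorem exists_root [Finite V] (hG : G.Connected) (h : IsSearchParent G par) :
    ∃ r, par r = none ∧ ∀ x, Desc par x r := by
  have := hG.nonempty
  obtain ⟨r, hr⟩ := Finite.exists_max (fun v => {x | Desc par x v}.ncard)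
  have hr0 : par r = none := by
    cases hp : par r with
    | none => rfl
    | some u => exact absurd (h.ncard_lt hp) (not_lt.2 (hr u))
  refine ⟨r, hr0, fun x => ?_⟩
  have := hG.preconnected r x
  rw [SimpleGraph.reachable_iff_reflTransGen] at this
  induction this with
  | refl => exact Relation.ReflTransGen.refl
  | tail _ hab ih =>
    rcases h.comparable hab with h1 | h1
    · rcases Desc.total h1 ih with h2 | h2
      · exact h2
      · rw [h2.eq_of_parent_eq_none hr0]; exact Relation.ReflTransGen.refl
    · exact h1.trans ih

/-- The search tree with a given parent function. -/
def toSearchTree [Finite V] (hG : G.Connected) (h : IsSearchParent G par) : SearchTree G where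
  parent := par
  isSearchTree := by
    obtain ⟨r, hr, hx⟩ := h.exists_root hG
    refine ⟨r, hr, ?_⟩
    have := h.isSearchTreeOn _ r rfl
    rwa [show {x | Desc par x r} = Set.univ from Set.eq_univ_of_forall hx] at this

end IsSearchParent

/-! ### Effect of a rotation on the ancestor order -/

namespace SearchTree

variable {T T' : SearchTree G} {u v w x y z : V}

theorem rotatedParent_child : T.rotatedParent u v v = T.parent u := by
  simp [rotatedParent]

theorem rotatedParent_parent (huv : u ≠ v) : T.rotatedParent u v u = some v := by
  simp [rotatedParent, huv]

theorem rotatedParent_cases (h : T.rotatedParent u v w = some z) :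
    (w = v ∧ T.parent u = some z) ∨ (w = u ∧ z = v) ∨
    (w ≠ v ∧ w ≠ u ∧ T.parent w = some v ∧ z = u ∧ ∃ s, Desc T.parent s w ∧ G.Adj u s) ∨
    (w ≠ v ∧ w ≠ u ∧ T.parent w = some z) := by
  unfold rotatedParent at h
  split_ifs at h with h1 h2 h3
  · exact Or.inl ⟨h1, h⟩
  · exact Or.inr (Or.inl ⟨h2, (Option.some.inj h).symm⟩)
  · exact Or.inr (Or.inr (Or.inl ⟨h1, h2, h3.1, (Option.some.inj h).symm, h3.2⟩))
  · exact Or.inr (Or.inr (Or.inr ⟨h1, h2, h⟩))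

/-- Every new parent was already an ancestor in `T`, except `v` as the parent of `u`; so only `v`
gains descendants. -/
theorem desc_of_rotated (hv : T.parent v = some u) (h : Desc (T.rotatedParent u v) x y) :
    Desc T.parent x y ∨ (y = v ∧ Desc T.parent x u) := by
  induction h using Relation.ReflTransGen.head_induction_on with
  | refl => exact Or.inl Relation.ReflTransGen.refl
  | head hab _ ih =>
    rcases rotatedParent_cases hab with ⟨rfl, hc⟩ | ⟨rfl, rfl⟩ | ⟨_, _, hc, rfl, _⟩ | ⟨_, _, hc⟩
    · have h1 : Desc T.parent _ _ := (Desc.of_parent hv).tail hc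
      rcases ih with ih | ⟨rfl, ih⟩
      · exact Or.inl (h1.trans ih)
      · exact Or.inl Relation.ReflTransGen.refl
    · rcases ih with ih | ⟨rfl, ih⟩
      · rcases ih.eq_or_of_parent hv with rfl | ih
        · exact Or.inr ⟨rfl, Relation.ReflTransGen.refl⟩
        · exact Or.inl ih
      · exact Or.inr ⟨rfl, Relation.ReflTransGen.refl⟩
    · have h1 : Desc T.parent _ _ := (Desc.of_parent hc).tail hv
      rcases ih with ih | ⟨rfl, ih⟩
      · exact Or.inl (h1.trans ih)
      · exact Or.inr ⟨rfl, h1⟩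
    · rcases ih with ih | ⟨rfl, ih⟩
      · exact Or.inl (ih.head hc)
      · exact Or.inr ⟨rfl, ih.head hc⟩

theorem rotated_desc_of_desc (huv : u ≠ v) (hv : T.parent v = some u) (h : Desc T.parent x y) :
    Desc (T.rotatedParent u v) x y ∨ (y = u ∧ Desc T.parent x v) := by
  have huv' : Desc (T.rotatedParent u v) u v := Desc.of_parent (rotatedParent_parent huv)
  induction h using Relation.ReflTransGen.head_induction_on with
  | refl => exact Or.inl Relation.ReflTransGen.refl
  | @head a b hab _ ih =>
    by_cases hav : a = v
    · subst hav
      rw [hv] at hab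
      obtain rfl := Option.some.inj hab
      rcases ih with ih | ⟨rfl, ih⟩
      · rcases ih.eq_or_of_parent (rotatedParent_parent huv) with rfl | ih
        · exact Or.inr ⟨rfl, Relation.ReflTransGen.refl⟩
        · exact Or.inl ih
      · exact Or.inr ⟨rfl, Relation.ReflTransGen.refl⟩
    have step : Desc (T.rotatedParent u v) a b := by
      by_cases hau : a = u
      · subst hau
        exact huv'.tail (by rw [rotatedParent_child, hab])
      · by_cases hm : T.parent a = some v ∧ ∃ s ∈ T.subtree a, G.Adj u s
        · have : b = v := by rw [hm.1] at hab; exact (Option.some.inj hab).symm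
          subst this
          exact huv'.head (by simp [rotatedParent, hav, hau, hm])
        · exact Desc.of_parent (by rw [rotatedParent, if_neg hav, if_neg hau, if_neg hm, hab])
    rcases ih with ih | ⟨rfl, ih⟩
    · exact Or.inl (step.trans ih)
    · exact Or.inr ⟨rfl, ih.head hab⟩

theorem rotated_not_desc (hT : IsSearchParent G T.parent) (hv : T.parent v = some u) :
    ¬ Desc (T.rotatedParent u v) v u := by
  have huv : u ≠ v := by rintro rfl; exact hT.parent_ne hv
  intro h
  cases hu : T.parent u with
  | none =>
    exact huv.symm (h.eq_of_parent_eq_none (by rw [rotatedParent_child, hu]))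
  | some z =>
    rcases h.eq_or_of_parent (by rw [rotatedParent_child, hu]) with h | h
    · exact huv.symm h
    · rcases desc_of_rotated hv h with h | ⟨h, _⟩
      · exact hT.parent_not_desc hu h
      · exact huv h

theorem isSearchParent_rotated (hT : IsSearchParent G T.parent) (hv : T.parent v = some u) :
    IsSearchParent G (T.rotatedParent u v) := by
  have huv : u ≠ v := by rintro rfl; exact hT.parent_ne hv
  have hdesc : ∀ {x y}, y ≠ u → Desc T.parent x y → Desc (T.rotatedParent u v) x y := by
    intro x y hy h
    exact (rotated_desc_of_desc huv hv h).resolve_right fun h => hy h.1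
  have hne : ∀ {c}, T.parent c = some v → c ≠ u := by
    rintro c hc rfl
    exact hT.parent_not_desc hv (Desc.of_parent hc)
  have hnev : ∀ {c}, T.parent c = some v → c ≠ v := by
    rintro c hc rfl
    exact hT.parent_ne hc
  have hmove : ∀ {c s}, T.parent c = some v → Desc T.parent s c → G.Adj u s →
      T.rotatedParent u v c = some u := by
    intro c s hc hs hadj
    have hm : T.parent c = some v ∧ ∃ s ∈ T.subtree c, G.Adj u s := ⟨hc, s, hs, hadj⟩
    simp [rotatedParent, hnev hc, hne hc, hm]
  have huv' : Desc (T.rotatedParent u v) u v := Desc.of_parent (rotatedParent_parent huv)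
  have hcomp : ∀ {x y}, G.Adj x y → Desc T.parent x y →
      Desc (T.rotatedParent u v) x y ∨ Desc (T.rotatedParent u v) y x := by
    intro x y hxy h
    rcases rotated_desc_of_desc huv hv h with h1 | ⟨rfl, h1⟩
    · exact Or.inl h1
    · rcases Relation.ReflTransGen.cases_tail h1 with rfl | ⟨c, hxc, hc⟩
      · exact Or.inr huv'
      -- The rule for moving subtrees enters here: the subtree of `c` contains the neighbour `x` of
      -- the rotated parent, so `c` is attached to that parent.
      · exact Or.inl ((hdesc (hne hc) hxc).tail (hmove hc hxc hxy.symm))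
  have hanti : ∀ {x y}, Desc (T.rotatedParent u v) x y → Desc (T.rotatedParent u v) y x →
      Desc T.parent x y → x = y := by
    intro x y h1 h2 h3
    rcases desc_of_rotated hv h2 with h4 | ⟨rfl, h4⟩
    · exact hT.antisymm h3 h4
    · rcases h3.eq_or_of_parent hv with h5 | h5
      · exact h5
      · obtain rfl := hT.antisymm h4 h5
        exact absurd h1 (rotated_not_desc hT hv)
  refine ⟨?_, ?_, ?_, ?_⟩
  · intro x y h1 h2
    rcases desc_of_rotated hv h1 with h3 | ⟨rfl, h3⟩
    · exact hanti h1 h2 h3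
    · rcases desc_of_rotated hv h2 with h4 | ⟨rfl, h4⟩
      · exact (hanti h2 h1 h4).symm
      · rfl
  · intro x hx
    rcases rotatedParent_cases hx with ⟨rfl, hc⟩ | ⟨rfl, h⟩ | ⟨_, h, hc, rfl, _⟩ | ⟨_, _, hc⟩
    · exact hT.parent_not_desc hv (Desc.of_parent hc)
    · exact huv h
    · exact h rfl
    · exact hT.parent_ne hc
  · intro x y hxy
    rcases hT.comparable hxy with h | h
    · exact hcomp hxy h
    · exact (hcomp hxy.symm h).symm
  · intro w z hw
    rcases rotatedParent_cases hw with ⟨rfl, hc⟩ | ⟨rfl, rfl⟩ | ⟨_, h, hc, rfl, s, hs, hadj⟩ |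
      ⟨_, h, hc⟩
    · obtain ⟨s, hs, hadj⟩ := hT.exists_adj hc
      refine ⟨s, ?_, hadj⟩
      rcases rotated_desc_of_desc huv hv hs with h1 | ⟨_, h1⟩
      · exact h1.trans huv'
      · exact hdesc huv.symm h1
    · obtain ⟨s, hs, hadj⟩ := hT.exists_adj hv
      rcases Relation.ReflTransGen.cases_tail hs with rfl | ⟨c, hsc, hc⟩
      · exact ⟨w, Relation.ReflTransGen.refl, hadj.symm⟩
      -- The subtree of `c` moves below the rotated parent and brings along a neighbour of `v`.
      · obtain ⟨t, ht, hadj'⟩ := hT.exists_adj hc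
        exact ⟨t, (hdesc (hne hc) ht).tail (hmove hc hsc hadj), hadj'⟩
    · exact ⟨s, hdesc h hs, hadj⟩
    · obtain ⟨s, hs, hadj⟩ := hT.exists_adj hc
      exact ⟨s, hdesc h hs, hadj⟩

theorem flip_of_rotation (hT : IsSearchParent G T.parent) (hv : T.parent v = some u)
    (hxy : x ≠ y) (h : Desc T.parent x y) (h' : Desc (T.rotatedParent u v) y x) :
    x = v ∧ y = u := by
  rcases desc_of_rotated hv h' with h1 | ⟨rfl, h1⟩
  · exact absurd (hT.antisymm h h1) hxy
  · rcases h.eq_or_of_parent hv with h2 | h2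
    · exact absurd h2 hxy
    · exact ⟨rfl, hT.antisymm h1 h2⟩

/-- The ancestor relation between `x` and `y` is reversed from `T` to `T'`. -/
def Flips (T T' : SearchTree G) (x y : V) : Prop :=
  (Desc T.parent x y ∧ Desc T'.parent y x) ∨ (Desc T.parent y x ∧ Desc T'.parent x y)

theorem flips_of_adj (hG : G.Connected) (h : (rotationGraph G).Adj T T') :
    ∃ u v, ∀ x y, x ≠ y → Flips T T' x y → (x = v ∧ y = u) ∨ (x = u ∧ y = v) := by
  obtain ⟨-, ⟨u, v, hv, h⟩ | ⟨u, v, hv, h⟩⟩ := h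
  · refine ⟨u, v, fun x y hxy hf => ?_⟩
    rw [Flips, h] at hf
    rcases hf with ⟨h1, h2⟩ | ⟨h1, h2⟩
    · exact Or.inl (flip_of_rotation (T.isSearchParent hG) hv hxy h1 h2)
    · exact Or.inr (flip_of_rotation (T.isSearchParent hG) hv hxy.symm h1 h2).symm
  · refine ⟨u, v, fun x y hxy hf => ?_⟩
    rw [Flips, h] at hf
    rcases hf with ⟨h1, h2⟩ | ⟨h1, h2⟩
    · exact Or.inr (flip_of_rotation (T'.isSearchParent hG) hv hxy.symm h2 h1).symm
    · exact Or.inl (flip_of_rotation (T'.isSearchParent hG) hv hxy h2 h1)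

/-! ### Sorting a search tree by labels -/

/-- The labels `σ` increase from parents to children. -/
def Increasing (T : SearchTree G) (σ : V → ℕ) : Prop :=
  ∀ v u, T.parent v = some u → σ u ≤ σ v

theorem Increasing.le_of_desc {σ : V → ℕ} (h : T.Increasing σ) (hxy : Desc T.parent x y) :
    σ y ≤ σ x := by
  induction hxy with
  | refl => rfl
  | tail _ hbc ih => exact (h _ _ hbc).trans ih

/-- Take the first step at which the label rises on the way from `x` up to `y`. -/
theorem exists_inverted_parent {par : V → Option V} {σ : V → ℕ} (h : Desc par x y)
    (hlt : σ x < σ y) : ∃ c z, par c = some z ∧ σ c < σ z ∧ σ c ≤ σ x := by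
  induction h using Relation.ReflTransGen.head_induction_on with
  | refl => exact absurd hlt (lt_irrefl _)
  | @head a b hab _ ih =>
    by_cases hl : σ a < σ b
    · exact ⟨a, b, hab, hl, le_rfl⟩
    · obtain ⟨c, z, h1, h2, h3⟩ := ih (by omega)
      exact ⟨c, z, h1, h2, by omega⟩

/-- The pairs of an ancestor and a descendant with a smaller label. -/
def inversions (T : SearchTree G) (σ : V → ℕ) : Set (V × V) :=
  {e | Desc T.parent e.2 e.1 ∧ σ e.2 < σ e.1}

/-- Rotate the inverted edge whose child `v` has the least label. A newly created relation puts `v`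
above some `x` in the subtree of `u`; if it were an inversion, the path from `x` to `u` would
contain an inverted edge whose child has a smaller label. -/
theorem exists_adj_inversions_lt [Finite V] (hG : G.Connected) (σ : V → ℕ)
    (hT : ¬ T.Increasing σ) :
    ∃ T' : SearchTree G, (rotationGraph G).Adj T T' ∧
      (T'.inversions σ).ncard < (T.inversions σ).ncard := by
  have hP := T.isSearchParent hG
  have hex : ∃ n v u, T.parent v = some u ∧ σ v < σ u ∧ σ v = n := by
    simp only [Increasing, not_forall, not_le] at hT
    obtain ⟨v, u, h, hlt⟩ := hT
    exact ⟨_, v, u, h, hlt, rfl⟩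
  classical
  obtain ⟨v, u, hv, hlt, hn⟩ := Nat.find_spec hex
  have hmin : ∀ c z, T.parent c = some z → σ c < σ z → σ v ≤ σ c := by
    intro c z h1 h2
    rw [hn]
    exact Nat.find_min' hex ⟨c, z, h1, h2, rfl⟩
  let T' := (isSearchParent_rotated hP hv).toSearchTree hG
  have hlt' : (T'.inversions σ).ncard < (T.inversions σ).ncard := by
    refine Set.ncard_lt_ncard ⟨?_, fun hsub => ?_⟩
    · rintro ⟨x, y⟩ ⟨h1, h2⟩
      refine ⟨?_, h2⟩
      rcases desc_of_rotated hv h1 with h3 | ⟨rfl, h3⟩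
      · exact h3
      · obtain ⟨c, z, h4, h5, h6⟩ := exists_inverted_parent h3 (h2.trans hlt)
        exact absurd (hmin c z h4 h5) (not_le.2 (h6.trans_lt h2))
    · have h1 : (u, v) ∈ T'.inversions σ := hsub ⟨Desc.of_parent hv, hlt⟩
      exact rotated_not_desc hP hv h1.1
  refine ⟨T', ⟨?_, Or.inl ⟨u, v, hv, rfl⟩⟩, hlt'⟩
  intro h
  rw [← h] at hlt'
  exact lt_irrefl _ hlt'

theorem exists_reachable_increasing [Finite V] (hG : G.Connected) (σ : V → ℕ) (T : SearchTree G) :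
    ∃ T', (rotationGraph G).Reachable T T' ∧ T'.Increasing σ := by
  induction hn : (T.inversions σ).ncard using Nat.strong_induction_on generalizing T with | _ n ih
  by_cases hT : T.Increasing σ
  · exact ⟨T, SimpleGraph.Reachable.refl _, hT⟩
  · obtain ⟨T₁, hadj, hlt⟩ := exists_adj_inversions_lt hG σ hT
    obtain ⟨T', h1, h2⟩ := ih _ (hn ▸ hlt) T₁ rfl
    exact ⟨T', hadj.reachable.trans h1, h2⟩

/-- Subtrees are connected, and an edge leaving the subtree of `y` leads to a smaller label. So the
labels determine the ancestor order, and with it the tree. -/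
theorem Increasing.desc_iff [Finite V] (hG : G.Connected) {σ : V → ℕ}
    (hσ : Function.Injective σ) (hT : T.Increasing σ) :
    Desc T.parent x y ↔ WalkIn G {z | σ y ≤ σ z} y x := by
  have hP := T.isSearchParent hG
  constructor
  · intro h
    exact ((hP.joined _ y rfl x h).symm).mono fun z hz => hT.le_of_desc hz
  · intro h
    refine h.mem_of_closed (P := {x | Desc T.parent x y}) Relation.ReflTransGen.refl ?_
    intro a b hab _ hb ha
    rcases hP.comparable hab with h1 | h1
    · rcases Desc.total h1 ha with h2 | h2
      · exact h2
      · have : σ b = σ y := le_antisymm (hT.le_of_desc h2) hb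
        rw [hσ this]; exact Relation.ReflTransGen.refl
    · exact h1.trans ha

theorem parent_eq_some_iff (hP : IsSearchParent G T.parent) :
    T.parent x = some y ↔ (x ≠ y ∧ Desc T.parent x y) ∧
      ∀ z, x ≠ z → Desc T.parent x z → Desc T.parent y z := by
  constructor
  · intro h
    refine ⟨⟨?_, Desc.of_parent h⟩, fun z hz hd => (hd.eq_or_of_parent h).resolve_left hz⟩
    rintro rfl
    exact hP.parent_ne h
  · rintro ⟨⟨hne, hd⟩, hmin⟩
    rcases Relation.ReflTransGen.cases_head hd with h | ⟨c, hc, h⟩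
    · exact absurd h hne
    · have hxc : x ≠ c := by rintro rfl; exact hP.parent_ne hc
      rwa [hP.antisymm (hmin c hxc (Desc.of_parent hc)) h]

theorem Increasing.unique [Finite V] (hG : G.Connected) {σ : V → ℕ}
    (hσ : Function.Injective σ) (hT : T.Increasing σ) (hT' : T'.Increasing σ) : T = T' := by
  have hd : ∀ x y, Desc T.parent x y ↔ Desc T'.parent x y := fun x y =>
    (hT.desc_iff hG hσ).trans (hT'.desc_iff hG hσ).symm
  ext x y
  rw [parent_eq_some_iff (T.isSearchParent hG), parent_eq_some_iff (T'.isSearchParent hG)]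
  simp only [hd]

end SearchTree

/-! ### Connectedness of the rotation graph -/

theorem rotationGraph_connected [Finite V] (hG : G.Connected) [Nonempty (SearchTree G)] :
    (rotationGraph G).Connected := by
  obtain ⟨σ, hσ⟩ : ∃ σ : V → ℕ, Function.Injective σ := Countable.exists_injective_nat V
  refine ⟨fun T T' => ?_⟩
  obtain ⟨T₁, h1, hi1⟩ := T.exists_reachable_increasing hG σ
  obtain ⟨T₂, h2, hi2⟩ := T'.exists_reachable_increasing hG σ
  rw [hi1.unique hG hσ hi2] at h1
  exact h1.trans h2.symm

instance [Finite V] : Finite (SearchTree G) :=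
  Finite.of_injective SearchTree.parent fun _ _ h => SearchTree.ext h

/-- Since `diam` is 0 when the extended diameter is infinite, connectedness and finiteness are
essential. -/
theorem dist_le_diam_rotationGraph [Finite V] (hG : G.Connected) (T T' : SearchTree G) :
    (rotationGraph G).dist T T' ≤ (rotationGraph G).diam := by
  have : Nonempty (SearchTree G) := ⟨T⟩
  exact SimpleGraph.dist_le_diam
    (SimpleGraph.connected_iff_ediam_ne_top.1 (rotationGraph_connected hG))

end ParentFunction

/-! ### Counting reversals, and trees on the complete bipartite graph -/

section CompleteBipartite

open Finset

namespace SearchTree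

variable {V : Type*} {G : SimpleGraph V} {T : SearchTree G} {x y : V}

theorem Increasing.desc_of_lt {σ : V → ℕ} (h : T.Increasing σ)
    (hc : Desc T.parent x y ∨ Desc T.parent y x) (hlt : σ y < σ x) : Desc T.parent x y :=
  hc.resolve_right fun h' => absurd (h.le_of_desc h') (not_le.2 hlt)

/-- Comparability at all times prevents the relation from first disappearing and later returning
reversed, with no single step being a flip. -/
theorem exists_flips {t : ℕ → SearchTree G} {i j : ℕ} (hij : i ≤ j)
    (hc : ∀ k ≤ j, Desc (t k).parent x y ∨ Desc (t k).parent y x)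
    (hi : Desc (t i).parent x y) (hj : Desc (t j).parent y x) (hxy : ¬ Desc (t j).parent x y) :
    ∃ k, i ≤ k ∧ k < j ∧ Flips (t k) (t (k + 1)) x y := by
  induction j, hij using Nat.le_induction with
  | base => exact absurd hi hxy
  | succ j hij ih =>
    by_cases h : Desc (t j).parent x y
    · exact ⟨j, hij, j.lt_succ_self, Or.inl ⟨h, hj⟩⟩
    · obtain ⟨k, h1, h2, h3⟩ := ih (fun k hk => hc k (by omega))
        ((hc j (by omega)).resolve_left h) h
      exact ⟨k, h1, by omega, h3⟩

theorem Flips.symm {T' : SearchTree G} (h : Flips T T' x y) : Flips T T' y x := Or.symm h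

open Classical in
/-- The number of the first `n` steps of `t` that reverse the ancestor relation of `x` and `y`. -/
noncomputable def flipCount (t : ℕ → SearchTree G) (n : ℕ) (x y : V) : ℕ :=
  #{k ∈ range n | Flips (t k) (t (k + 1)) x y}

/-- Double counting: each step flips at most one unordered pair, and `I` contains it in at most one
orientation. -/
theorem sum_flipCount_le (hG : G.Connected) {t : ℕ → SearchTree G} {n : ℕ}
    (ht : ∀ k < n, (rotationGraph G).Adj (t k) (t (k + 1))) (I : Finset (V × V))
    (hne : ∀ e ∈ I, e.1 ≠ e.2) (hI : ∀ e ∈ I, e.swap ∉ I) :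
    ∑ e ∈ I, flipCount t n e.1 e.2 ≤ n := by
  classical
  have h1 : ∑ e ∈ I, flipCount t n e.1 e.2 =
      ∑ k ∈ range n, #{e ∈ I | Flips (t k) (t (k + 1)) e.1 e.2} :=
    sum_card_bipartiteAbove_eq_sum_card_bipartiteBelow
      (fun (e : V × V) k => Flips (t k) (t (k + 1)) e.1 e.2)
  rw [h1]
  calc _ ≤ ∑ k ∈ range n, 1 := sum_le_sum fun k hk => ?_
    _ = n := by simp
  obtain ⟨u, v, huv⟩ := flips_of_adj hG (ht k (mem_range.1 hk))
  rw [card_le_one]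
  rintro ⟨a, b⟩ h2 ⟨c, d⟩ h3
  simp only [mem_filter] at h2 h3
  have h4 := huv a b (hne _ h2.1) h2.2
  have h5 := huv c d (hne _ h3.1) h3.2
  have h6 := hI _ h2.1
  rcases h4 with ⟨rfl, rfl⟩ | ⟨rfl, rfl⟩ <;> rcases h5 with ⟨rfl, rfl⟩ | ⟨rfl, rfl⟩
  · rfl
  · exact absurd h3.1 h6
  · exact absurd h3.1 h6
  · rfl

variable {t : ℕ → SearchTree G} {n : ℕ}

theorem one_le_flipCount (hG : G.Connected) (hxy : x ≠ y)
    (hc : ∀ k ≤ n, Desc (t k).parent x y ∨ Desc (t k).parent y x)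
    (h0 : Desc (t 0).parent x y) (hn : Desc (t n).parent y x) :
    1 ≤ flipCount t n x y := by
  obtain ⟨k, -, h2, h3⟩ := exists_flips (Nat.zero_le n) hc h0 hn
    fun h => hxy (((t n).isSearchParent hG).antisymm h hn)
  exact card_pos.2 ⟨k, by simp [h2, h3]⟩

theorem two_le_flipCount (hG : G.Connected) (hxy : x ≠ y)
    (hc : ∀ k ≤ n, Desc (t k).parent x y ∨ Desc (t k).parent y x) {m : ℕ} (hm : m ≤ n)
    (h0 : Desc (t 0).parent x y) (hm' : Desc (t m).parent y x) (hn : Desc (t n).parent x y) :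
    2 ≤ flipCount t n x y := by
  obtain ⟨k, -, h2, h3⟩ := exists_flips (Nat.zero_le m) (fun k hk => hc k (hk.trans hm)) h0 hm'
    fun h => hxy (((t m).isSearchParent hG).antisymm h hm')
  obtain ⟨k', h2', h3', h4'⟩ := exists_flips hm (fun k hk => (hc k hk).symm) hm' hn
    fun h => hxy (((t n).isSearchParent hG).antisymm hn h)
  refine one_lt_card.2 ⟨k, ?_, k', ?_, by omega⟩
  · simp only [mem_filter, mem_range]; exact ⟨by omega, h3⟩
  · simp only [mem_filter, mem_range]; exact ⟨by omega, h4'.symm⟩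

end SearchTree

theorem completeBipartiteGraph_connected {p q : ℕ} (hp : 0 < p) (hq : 0 < q) :
    (completeBipartiteGraph (Fin p) (Fin q)).Connected := by
  have key : ∀ i j, (completeBipartiteGraph (Fin p) (Fin q)).Adj (Sum.inl i) (Sum.inr j) := by
    simp
  have : Nonempty (Fin p ⊕ Fin q) := ⟨Sum.inl ⟨0, hp⟩⟩
  have h : ∀ x, (completeBipartiteGraph (Fin p) (Fin q)).Reachable x (Sum.inl ⟨0, hp⟩) := by
    rintro (i | j)
    · exact (key i ⟨0, hq⟩).reachable.trans (key _ _).symm.reachable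
    · exact (key _ j).symm.reachable
  exact ⟨fun x y => (h x).trans (h y).symm⟩

/-- The first part forms a path starting at the root, and the second part consists of leaves below
its end. -/
theorem exists_isSearchParent_completeBipartiteGraph {p q : ℕ} (hp : 0 < p) (hq : 0 < q) :
    ∃ par, IsSearchParent (completeBipartiteGraph (Fin p) (Fin q)) par := by
  let par : Fin p ⊕ Fin q → Option (Fin p ⊕ Fin q) := Sum.elim
    (fun i => if i.1 = 0 then none else some (Sum.inl ⟨i - 1, by omega⟩))
    (fun _ => some (Sum.inl ⟨p - 1, by omega⟩))
  let lab : Fin p ⊕ Fin q → ℕ := Sum.elim (fun i => i) (fun _ => p)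
  have hlt : ∀ {x y}, par x = some y → lab y < lab x := by
    rintro (i | j) y h
    · simp only [par, Sum.elim_inl] at h
      split_ifs at h with h0
      obtain rfl := Option.some.inj h
      simp only [lab, Sum.elim_inl]
      omega
    · obtain rfl := Option.some.inj h
      exact Nat.sub_lt hp one_pos
  have hle : ∀ {x y}, Desc par x y → lab y ≤ lab x := by
    intro x y h
    induction h with
    | refl => rfl
    | tail _ h ih => exact (hlt h).le.trans ih
  have hdown : ∀ (d i : ℕ) (h : i + d < p),
      Desc par (Sum.inl ⟨i + d, h⟩) (Sum.inl ⟨i, by omega⟩) := by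
    intro d
    induction d with
    | zero => intro i _; exact Relation.ReflTransGen.refl
    | succ d ih =>
      intro i h
      refine Relation.ReflTransGen.head ?_ (ih i (by omega))
      simp [par]
  have hdown' : ∀ j i, Desc par (Sum.inr j) (Sum.inl i) := by
    intro j i
    refine Relation.ReflTransGen.head (b := Sum.inl ⟨p - 1, by omega⟩) rfl ?_
    have hi : (⟨p - 1, by omega⟩ : Fin p) = ⟨i + (p - 1 - i), by omega⟩ :=
      Fin.ext (show p - 1 = i + (p - 1 - i) by omega)
    rw [hi]
    exact hdown (p - 1 - i) i (by omega)
  refine ⟨par, ?_, ?_, ?_, ?_⟩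
  · intro x y h1 h2
    rcases Relation.ReflTransGen.cases_head h1 with h | ⟨c, hc, h⟩
    · exact h
    · exact absurd ((hle h2).trans (hle h)) (not_le.2 (hlt hc))
  · intro x h
    exact lt_irrefl _ (hlt h)
  · rintro (i | j) (i' | j') h
    · simp at h
    · exact Or.inr (hdown' _ _)
    · exact Or.inl (hdown' _ _)
    · simp at h
  · rintro (i | j) y h
    · simp only [par, Sum.elim_inl] at h
      split_ifs at h with h0
      obtain rfl := Option.some.inj h
      exact ⟨Sum.inr ⟨0, hq⟩, hdown' _ _, by simp⟩
    · obtain rfl := Option.some.inj h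
      exact ⟨Sum.inr j, Relation.ReflTransGen.refl, by simp⟩

theorem exists_increasing_searchTree {p q : ℕ} (hp : 0 < p) (hq : 0 < q)
    (σ : Fin p ⊕ Fin q → ℕ) :
    ∃ T : SearchTree (completeBipartiteGraph (Fin p) (Fin q)), T.Increasing σ := by
  have hG := completeBipartiteGraph_connected hp hq
  obtain ⟨par, h⟩ := exists_isSearchParent_completeBipartiteGraph hp hq
  obtain ⟨T, -, hT⟩ := (h.toSearchTree hG).exists_reachable_increasing hG σ
  exact ⟨T, hT⟩

theorem card_filter_lt_eq_choose_two {α : Type*} [LinearOrder α] (S : Finset α) :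
    #{e ∈ S ×ˢ S | e.1 < e.2} = (#S).choose 2 := by
  have h1 : #{e ∈ S ×ˢ S | e.1 < e.2} = #{e ∈ S ×ˢ S | e.2 < e.1} :=
    card_bij' (fun e _ => e.swap) (fun e _ => e.swap) (by simp +contextual) (by simp +contextual)
      (by simp) (by simp)
  have h2 : S.offDiag = {e ∈ S ×ˢ S | e.1 < e.2} ∪ {e ∈ S ×ˢ S | e.2 < e.1} := by
    ext ⟨a, b⟩
    simp only [mem_offDiag, mem_union, mem_filter, mem_product, ne_eq, ← lt_or_lt_iff_ne]
    tauto
  have h3 : Disjoint {e ∈ S ×ˢ S | e.1 < e.2} {e ∈ S ×ˢ S | e.2 < e.1} := by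
    rw [disjoint_filter]
    intro e _ h h'
    exact lt_asymm h h'
  have h4 := congrArg card h2
  rw [card_union_of_disjoint h3, ← h1, offDiag_card] at h4
  rw [Nat.choose_two_right, Nat.mul_sub_one]
  omega

/-- A lower bound for the distance of two search trees on `K_{p,q}`: in the first, the vertices `b_j` of
the second part precede those of the first part; in the second, their order is reversed and
`h j` vertices of the first part are below `b_j`. -/
theorem exists_le_diam {p q : ℕ} (hp : 0 < p) (hq : 0 < q) (h : Fin q → ℕ)
    (hle : ∀ j, h j ≤ p) (hmono : Monotone h) :
    ∃ S : Finset (Fin q),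
      (∑ j ∈ S, (p + h j) + ∑ j ∈ Sᶜ, (p - h j)) + (q.choose 2 - (#S).choose 2) ≤
        (rotationGraph (completeBipartiteGraph (Fin p) (Fin q))).diam := by
  classical
  have hG := completeBipartiteGraph_connected hp hq
  let σ₁ : Fin p ⊕ Fin q → ℕ := Sum.elim (fun i => q + i) (fun j => j)
  -- Labels come in blocks of length q + 1. Block i ends with a_i, and b_j sits in block p - h j, so
  -- it precedes exactly the a_i with p ≤ i + h j. Within a block the b_j are in decreasing order of
  -- j.
  let σ₂ : Fin p ⊕ Fin q → ℕ := Sum.elim (fun i => i * (q + 1) + q)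
    (fun j => (p - h j) * (q + 1) + (q - 1 - j))
  obtain ⟨T₁, hT₁⟩ := exists_increasing_searchTree hp hq σ₁
  obtain ⟨T₂, hT₂⟩ := exists_increasing_searchTree hp hq σ₂
  have hnonempty : Nonempty (SearchTree (completeBipartiteGraph (Fin p) (Fin q))) := ⟨T₁⟩
  obtain ⟨w, hw⟩ := (rotationGraph_connected hG).exists_walk_length_eq_dist T₁ T₂
  set n := w.length with hn
  let t := w.getVert
  have ht0 : t 0 = T₁ := w.getVert_zero
  have htn : t n = T₂ := w.getVert_length
  have hP : ∀ k, IsSearchParent (completeBipartiteGraph (Fin p) (Fin q)) (t k).parent :=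
    fun k => (t k).isSearchParent hG
  have hab : ∀ k i j, Desc (t k).parent (Sum.inl i) (Sum.inr j) ∨
      Desc (t k).parent (Sum.inr j) (Sum.inl i) := fun k i j => (hP k).comparable (by simp)
  have hbb : ∀ k i j j', Desc (t k).parent (Sum.inl i) (Sum.inr j) →
      Desc (t k).parent (Sum.inr j) (Sum.inr j') ∨ Desc (t k).parent (Sum.inr j') (Sum.inr j) := by
    intro k i j j' h1
    rcases hab k i j' with h2 | h2
    · exact Desc.total h1 h2
    · exact Or.inr (h2.trans h1)
  have hab₁ : ∀ i j, Desc (t 0).parent (Sum.inl i) (Sum.inr j) := fun i j => by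
    have := hab 0 i j
    rw [ht0] at this ⊢
    exact hT₁.desc_of_lt this (by simp only [σ₁, Sum.elim_inl, Sum.elim_inr]; omega)
  have hab₂ : ∀ (i : Fin p) j, p ≤ i + h j → Desc (t n).parent (Sum.inl i) (Sum.inr j) := fun i j hij => by
    have := hab n i j
    rw [htn] at this ⊢
    refine hT₂.desc_of_lt this ?_
    have h1 : (p - h j) * (q + 1) ≤ i * (q + 1) := Nat.mul_le_mul_right _ (by omega)
    simp only [σ₂, Sum.elim_inl, Sum.elim_inr]
    omega
  have hba₂ : ∀ (i : Fin p) j, i + h j < p →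
      Desc (t n).parent (Sum.inr j) (Sum.inl i) := fun i j hij => by
    have := (hab n i j).symm
    rw [htn] at this ⊢
    refine hT₂.desc_of_lt this ?_
    have h1 : (i + 1) * (q + 1) ≤ (p - h j) * (q + 1) := Nat.mul_le_mul_right _ (by omega)
    rw [Nat.add_mul] at h1
    simp only [σ₂, Sum.elim_inl, Sum.elim_inr]
    omega
  -- For j outside `S` some a_i is below b_j at every time, which keeps b_j comparable with all
  -- other b_j'.
  let S : Finset (Fin q) := {j | ∃ k ≤ n, ∀ i, Desc (t k).parent (Sum.inr j) (Sum.inl i)}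
  have hS : ∀ j, j ∉ S → ∀ k ≤ n, ∃ i, Desc (t k).parent (Sum.inl i) (Sum.inr j) := by
    intro j hj k hk
    by_contra! hcon
    exact hj (by
      simp only [S, mem_filter, mem_univ, true_and]
      exact ⟨k, hk, fun i => (hab k i j).resolve_left (hcon i)⟩)
  have hcount : ∀ j, ∑ i : Fin p, (if p ≤ i + h j then 1 else 0) = h j := by
    intro j
    have h1 := Fin.sum_univ_eq_sum_range (fun i => if p ≤ i + h j then 1 else 0) p
    rw [h1, ← card_filter]
    have h2 : {i ∈ range p | p ≤ i + h j} = Ico (p - h j) p := by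
      ext i; simp only [mem_filter, mem_range, mem_Ico]; omega
    rw [h2, Nat.card_Ico]
    have := hle j
    omega
  have hin : ∀ j ∈ S, p + h j ≤ ∑ i, SearchTree.flipCount t n (Sum.inl i) (Sum.inr j) := by
    intro j hj
    simp only [S, mem_filter, mem_univ, true_and] at hj
    obtain ⟨m, hm, hmj⟩ := hj
    calc p + h j = ∑ i : Fin p, (1 + if p ≤ i + h j then 1 else 0) := by
          rw [sum_add_distrib, hcount]; simp
      _ ≤ _ := sum_le_sum fun i _ => ?_
    split_ifs with hi
    · exact SearchTree.two_le_flipCount hG (by simp) (fun k _ => hab k i j) hm (hab₁ i j) (hmj i)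
        (hab₂ i j hi)
    · exact SearchTree.one_le_flipCount hG (by simp) (fun k _ => hab k i j) (hab₁ i j)
        (hba₂ i j (by omega))
  have hout : ∀ j, p - h j ≤ ∑ i, SearchTree.flipCount t n (Sum.inl i) (Sum.inr j) := by
    intro j
    have h1 : p ≤ ∑ i : Fin p, (SearchTree.flipCount t n (Sum.inl i) (Sum.inr j) +
        if p ≤ i + h j then 1 else 0) := by
      calc p = ∑ i : Fin p, 1 := by simp
        _ ≤ _ := sum_le_sum fun i _ => ?_
      split_ifs with hi
      · omega
      · exact SearchTree.one_le_flipCount hG (by simp) (fun k _ => hab k i j) (hab₁ i j)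
          (hba₂ i j (by omega))
    rw [sum_add_distrib, hcount] at h1
    omega
  have hpair : ∀ j j', j < j' → ¬ (j ∈ S ∧ j' ∈ S) →
      1 ≤ SearchTree.flipCount t n (Sum.inr j') (Sum.inr j) := by
    intro j j' hjj hnot
    have hc : ∀ k ≤ n, Desc (t k).parent (Sum.inr j') (Sum.inr j) ∨
        Desc (t k).parent (Sum.inr j) (Sum.inr j') := by
      intro k hk
      by_cases hj : j ∈ S
      · obtain ⟨i, hi⟩ := hS j' (fun h => hnot ⟨hj, h⟩) k hk
        exact hbb k i j' j hi
      · obtain ⟨i, hi⟩ := hS j hj k hk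
        exact (hbb k i j j' hi).symm
    refine SearchTree.one_le_flipCount hG (by simpa using hjj.ne') hc ?_ ?_
    · have := hc 0 (Nat.zero_le n)
      rw [ht0] at this ⊢
      exact hT₁.desc_of_lt this (by simpa [σ₁] using hjj)
    · have := (hc n le_rfl).symm
      rw [htn] at this ⊢
      refine hT₂.desc_of_lt this ?_
      have h1 : (p - h j') * (q + 1) ≤ (p - h j) * (q + 1) :=
        Nat.mul_le_mul_right _ (Nat.sub_le_sub_left (hmono hjj.le) p)
      simp only [σ₂, Sum.elim_inr]
      omega
  refine ⟨S, le_trans ?_ (hw ▸ dist_le_diam_rotationGraph hG T₁ T₂)⟩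
  let I₁ : Finset ((Fin p ⊕ Fin q) × (Fin p ⊕ Fin q)) :=
    (univ : Finset (Fin q × Fin p)).image fun e => (Sum.inl e.2, Sum.inr e.1)
  let I₂ : Finset ((Fin p ⊕ Fin q) × (Fin p ⊕ Fin q)) :=
    ({e | e.1 < e.2} : Finset (Fin q × Fin q)).image fun e => (Sum.inr e.2, Sum.inr e.1)
  have hdisj : Disjoint I₁ I₂ := by
    rw [disjoint_left]
    intro e h1 h2
    simp only [I₁, I₂, mem_image, mem_univ, true_and] at h1 h2
    obtain ⟨a, rfl⟩ := h1
    obtain ⟨b, -, hb⟩ := h2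
    simp at hb
  have hsum := SearchTree.sum_flipCount_le hG (t := t) (n := n)
    (fun k hk => w.adj_getVert_succ hk) (I₁ ∪ I₂) (by
      intro e he
      simp only [I₁, I₂, mem_union, mem_image, mem_univ, true_and, mem_filter] at he
      rcases he with ⟨a, rfl⟩ | ⟨a, ha, rfl⟩
      · simp
      · simpa using ha.ne') (by
      intro e he he'
      simp only [I₁, I₂, mem_union, mem_image, mem_univ, true_and, mem_filter] at he he'
      rcases he with ⟨a, rfl⟩ | ⟨a, ha, rfl⟩ <;> rcases he' with ⟨b, hb⟩ | ⟨b, hb, hb'⟩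
      · simp at hb
      · simp at hb'
      · simp at hb
      · simp only [Prod.swap_prod_mk, Prod.mk.injEq, Sum.inr.injEq] at hb'
        rw [hb'.1, hb'.2] at hb
        exact lt_asymm ha hb)
  rw [sum_union hdisj, sum_image (by rintro ⟨a, b⟩ - ⟨c, d⟩ -; simp; tauto),
    sum_image (by rintro ⟨a, b⟩ - ⟨c, d⟩ -; simp; tauto)] at hsum
  refine le_trans (add_le_add ?_ ?_) hsum
  · rw [Fintype.sum_prod_type, ← sum_add_sum_compl S]
    exact add_le_add (sum_le_sum hin) (sum_le_sum fun j _ => hout j)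
  · have h1 := card_filter_lt_eq_choose_two (univ : Finset (Fin q))
    rw [card_univ, Fintype.card_fin, univ_product_univ] at h1
    rw [← h1, ← card_filter_lt_eq_choose_two S]
    refine (le_card_sdiff _ _).trans ?_
    rw [card_eq_sum_ones]
    refine (sum_le_sum fun e he => ?_).trans (sum_le_sum_of_subset sdiff_subset)
    simp only [mem_sdiff, mem_filter, mem_univ, true_and, mem_product] at he
    exact hpair _ _ he.1 fun hh => he.2 ⟨hh, he.1⟩

end CompleteBipartite

/-! ### Choice of the heights -/

section BalancedHeights

open Finset

/-- A nondecreasing integer sequence of length `q` and sum `k` whose values differ by at most 1. -/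
theorem exists_balanced {q : ℕ} (hq : 0 < q) (k : ℕ) :
    ∃ h : Fin q → ℕ, Monotone h ∧ (∀ j, k / q ≤ h j) ∧ (∀ j, h j ≤ k / q + 1) ∧
      (∀ c, k ≤ c * q → ∀ j, h j ≤ c) ∧ ∑ j, h j = k := by
  have hk := Nat.div_add_mod' k q
  have hr := Nat.mod_lt k hq
  set m := k / q
  set r := k % q
  refine ⟨fun j => m + if q ≤ j + r then 1 else 0, ?_, ?_, ?_, ?_, ?_⟩
  · intro i j hij
    have : i.1 ≤ j.1 := hij
    dsimp only
    split_ifs <;> omega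
  · intro j
    exact Nat.le_add_right _ _
  · intro j
    dsimp only
    split_ifs <;> omega
  · intro c hc j
    dsimp only
    split_ifs with hj
    · by_contra! hcm
      have : c * q ≤ m * q := Nat.mul_le_mul_right _ (by omega)
      omega
    · by_contra! hcm
      have : (c + 1) * q ≤ m * q := Nat.mul_le_mul_right _ (by omega)
      rw [Nat.add_mul] at this
      omega
  · have h1 := Fin.sum_univ_eq_sum_range (fun i => if q ≤ i + r then 1 else 0) q
    have h2 : {i ∈ range q | q ≤ i + r} = Ico (q - r) q := by
      ext i; simp only [mem_filter, mem_range, mem_Ico]; omega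
    rw [← card_filter (fun i => q ≤ i + r) (range q), h2, Nat.card_Ico] at h1
    rw [sum_add_distrib, h1, sum_const, card_univ, Fintype.card_fin, smul_eq_mul, mul_comm]
    omega

theorem two_mul_choose_two (n : ℕ) : 2 * n.choose 2 + n = n * n := by
  rw [Nat.choose_two_right, Nat.mul_div_cancel' (Nat.even_mul_pred_self n).two_dvd,
    Nat.mul_sub_one, Nat.sub_add_cancel (Nat.le_mul_self n)]

/-- With m = k / q and s = |S|, a small s is settled by Σ_S h ≥ sm. For large s, bound the sum over
the complement by c(m + 1), where c = q - s, and use C(q,2) - C(s,2) = c(2s + c - 1)/2. -/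
theorem choose_two_le_two_mul_sum {q k : ℕ} {h : Fin q → ℕ} (hl : ∀ j, k / q ≤ h j)
    (hu : ∀ j, h j ≤ k / q + 1) (hsum : ∑ j, h j = k) (hk : q.choose 2 ≤ 2 * k)
    (S : Finset (Fin q)) : (#S).choose 2 ≤ 2 * ∑ j ∈ S, h j := by
  set m := k / q
  have h1 : #S * m ≤ ∑ j ∈ S, h j := by
    simpa using card_nsmul_le_sum S h m fun j _ => hl j
  have h2 : ∑ j ∈ Sᶜ, h j ≤ #Sᶜ * (m + 1) := by
    simpa using sum_le_card_nsmul Sᶜ h (m + 1) fun j _ => hu j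
  have h3 := sum_add_sum_compl S h
  have h4 : #S + #Sᶜ = q := by simp
  have h5 := two_mul_choose_two q
  have h6 := two_mul_choose_two #S
  rw [hsum] at h3
  generalize #S = s at *
  generalize #Sᶜ = c at *
  subst h4
  generalize ∑ j ∈ S, h j = x at *
  generalize ∑ j ∈ Sᶜ, h j = y at *
  by_cases hs : s ≤ 4 * m + 1
  · have : s * s ≤ s * (4 * m + 1) := Nat.mul_le_mul_left s hs
    nlinarith
  -- For c = 0 the claim is the hypothesis on k; the estimate 4(m + 1) ≤ 2s + c - 1 needs c ≥ 1.
  · rcases Nat.eq_zero_or_pos c with rfl | hc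
    · have hk' : s.choose 2 ≤ 2 * k := hk
      rw [zero_mul] at h2
      omega
    · have : 4 * (m + 1) * c ≤ (2 * s + c - 1) * c := Nat.mul_le_mul_right c (by omega)
      have h7 : (2 * s + c - 1) * c + c = (2 * s + c) * c := by
        rw [Nat.sub_mul, one_mul, Nat.sub_add_cancel]
        exact Nat.le_mul_of_pos_left c (by omega)
      nlinarith

end BalancedHeights

/-! ### The diameter bound -/

theorem mainTheorem11 (p q : ℕ) (hp : 0 < p) (hq : 0 < q)
    (hlow : min (2 : ℚ) ((p : ℚ) / 4) ≤ (q : ℚ)) (hup : q ≤ 4 * p) :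
    p * q + ⌊(1 / 2 : ℚ) * (q.choose 2 : ℚ)⌋₊ ≤
        (rotationGraph (completeBipartiteGraph (Fin p) (Fin q))).diam ∧
      q.choose 2 < p * q + ⌊(1 / 2 : ℚ) * (q.choose 2 : ℚ)⌋₊ := by
  have hfloor : ⌊(1 / 2 : ℚ) * (q.choose 2 : ℚ)⌋₊ = q.choose 2 / 2 := by
    rw [← Nat.floor_div_eq_div (K := ℚ)]
    congr 1
    push_cast
    ring
  rw [hfloor]
  have hC := two_mul_choose_two q
  have hqq : q * q ≤ 4 * (p * q) := by
    rw [← mul_assoc]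
    exact Nat.mul_le_mul_right q hup
  have hpq : 0 < p * q := Nat.mul_pos hp hq
  refine ⟨?_, ?_⟩
  swap
  -- From 2 C(q,2) + q ≤ 4pq one gets ⌈C(q,2)/2⌉ < pq once q ≥ 3; for smaller q the rounding is too
  -- coarse.
  · rcases lt_or_ge q 3 with h | h
    · interval_cases q <;> simp <;> omega
    · omega
  -- The sum ⌈C(q,2)/2⌉ is the least k with C(q,2) ≤ 2k, and it leaves C(q,2) - k = ⌊C(q,2)/2⌋ in
  -- the bound. It is at most pq because q ≤ 4p, so all heights are at most p.
  obtain ⟨h, hmono, hl, hu, hle, hsum⟩ := exists_balanced hq (q.choose 2 - q.choose 2 / 2)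
  have hhp : ∀ j, h j ≤ p := hle p (by omega)
  obtain ⟨S, hS⟩ := exists_le_diam hp hq h hhp hmono
  refine le_trans ?_ hS
  have hS2 := choose_two_le_two_mul_sum hl hu hsum (by omega) S
  have h1 := Finset.sum_add_sum_compl S h
  have h2 : ∑ j ∈ Sᶜ, (p - h j) + ∑ j ∈ Sᶜ, h j = Sᶜ.card * p := by
    rw [← Finset.sum_add_distrib, Finset.sum_congr rfl fun j _ => Nat.sub_add_cancel (hhp j)]
    simp
  have h3 : S.card * p + Sᶜ.card * p = p * q := by
    rw [← Nat.add_mul, Finset.card_add_card_compl, Fintype.card_fin, mul_comm]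
  have h4 : S.card.choose 2 ≤ q.choose 2 :=
    Nat.choose_le_choose 2 (by simpa using Finset.card_le_univ S)
  rw [Finset.sum_add_distrib, Finset.sum_const, smul_eq_mul]
  omega
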